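/- Let $n\ge 0$, $N=2^n$, and let $G_N=\begin{bmatrix}1&0\\1&1\end{bmatrix}^{\otimes n}$ over $\mathbb F_2$, with rows $g_0,\dots,g_{N-1}$. Let $w(\cdot)$ denote Hamming weight, and for $i\in[0,N-1]$ let $S_i\subseteq[0,n-1]$ be the set of positions of the ones in the binary representation of $i$ (position $0$ being the least significant bit). Let $\preceq$ be the smallest transitive relation on $[0,N-1]$ such that $i\preceq j$ whenever $S_i\subseteq S_j$, and whenever $S_j=(S_i\setminus\{a\})\cup\{b\}$ with $a\in S_i$, $b\in[0,n-1]\setminus S_i$ and $a<b$. Let $I\subseteq[0,N-1]$ satisfy the Partial Order Property: $i\in I$ and $i\preceq k$ imply $k\in I$. For $J\subseteq[0,N-1]$ let $C(J)$ be the linear code spanned by $\{g_i: i\in J\}$, and let $A_{d_{\min}}(J)$ be the number of codewords of $C(J)$ whose weight equals the minimum distance of $C(J)$. Let $w_{\min}$ be the minimum distance of $C(I)$ and put $$B=\{i\in I: w(g_i)=w_{\min}\},\qquad B^c=\{i\in[0,N-1]\setminus I: w(g_i)=w_{\min}\},$$ $$K_i=\{j\in[i+1,N-1]: w(g_j)\ge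 w(g_i+g_j)=w(g_i)\},$$ $$E_j=\{i\in[0,j-1]: |S_i|=\log_2 w_{\min},\ |S_j\cap S_i|=|S_j|-1\},\qquad D_j=E_j\cap B.$$ If $j\in B$ and $i\in E_j\cap B^c$ satisfy $$\sum_{x\in D_j}2^{|K_x|-1}+2^{|K_j|}>2^{|K_i|-1},$$ then the set $I'=\{i\}\cup(I\setminus\{j\})$ satisfies $A_{d_{\min}}(I')<A_{d_{\min}}(I)$. -/

import Mathlib

namespace PolarCode

/-- The `2 × 2` kernel `G₂ = [1 0; 1 1]` over `𝔽₂`. -/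
def kernel : Matrix (Fin 2) (Fin 2) (ZMod 2) := !![1, 0; 1, 1]

/-- The standard (row-major) identification of pairs with indices: `(a, b) ↦ b + 2 ^ n * a`. -/
def pairEquiv (n : ℕ) : Fin 2 × Fin (2 ^ n) ≃ Fin (2 ^ (n + 1)) :=
  finProdFinEquiv.trans (finCongr (pow_succ' 2 n).symm)

/-- The polar transform `G_N = G₂^{⊗ n}`, `N = 2 ^ n`: the `n`-th Kronecker power of `G₂`. -/
def polarTransform : (n : ℕ) → Matrix (Fin (2 ^ n)) (Fin (2 ^ n)) (ZMod 2)
  | 0 => 1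
  | n + 1 => Matrix.reindex (pairEquiv n) (pairEquiv n)
      (Matrix.kroneckerMap (· * ·) kernel (polarTransform n))

/-- The row `g_i` of the polar transform. -/
def row {n : ℕ} (i : Fin (2 ^ n)) : Fin (2 ^ n) → ZMod 2 := polarTransform n i

/-- `S_i`, the support of the binary representation of `i` (bit `0` is the least significant). -/
def binSupp {n : ℕ} (i : Fin (2 ^ n)) : Finset (Fin n) :=
  Finset.univ.filter fun a => i.val.testBit a.val = true

/-- The partial order `i ≼ j` on `[0, 2 ^ n - 1]`. -/
inductive PO {n : ℕ} : Fin (2 ^ n) → Fin (2 ^ n) → Prop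
  | subset {i j : Fin (2 ^ n)} (h : binSupp i ⊆ binSupp j) : PO i j
  | swap {i j : Fin (2 ^ n)} (a b : Fin n) (ha : a ∈ binSupp i) (hb : b ∉ binSupp i)
      (hab : a < b) (h : binSupp j = insert b ((binSupp i).erase a)) : PO i j
  | trans {i k j : Fin (2 ^ n)} (hik : PO i k) (hkj : PO k j) : PO i j

/-- The Partial Order Property of an information set. -/
def PartialOrderProperty {n : ℕ} (I : Finset (Fin (2 ^ n))) : Prop :=
  ∀ i ∈ I, ∀ k ∉ I, ¬ PO i k

/-- The linear code `C(I)` generated by the rows `g_i`, `i ∈ I`. -/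
def code {n : ℕ} (I : Finset (Fin (2 ^ n))) : Submodule (ZMod 2) (Fin (2 ^ n) → ZMod 2) :=
  Submodule.span (ZMod 2) (row '' (I : Set (Fin (2 ^ n))))

/-- The minimum distance `d_min = w_min` of `C(I)`. -/
noncomputable def minDist {n : ℕ} (I : Finset (Fin (2 ^ n))) : ℕ :=
  sInf {d | ∃ c ∈ code I, ∃ c' ∈ code I, c ≠ c' ∧ hammingDist c c' = d}

/-- The error coefficient `A_{d_min}(I)`: the number of codewords of `C(I)` of weight `d_min`. -/
noncomputable def errorCoeff {n : ℕ} (I : Finset (Fin (2 ^ n))) : ℕ :=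
  Set.ncard {c | c ∈ code I ∧ hammingNorm c = minDist I}

/-- `K_i = {j > i : w(g_j) ≥ w(g_i + g_j) = w(g_i)}`. -/
def setK {n : ℕ} (i : Fin (2 ^ n)) : Finset (Fin (2 ^ n)) :=
  Finset.univ.filter fun j => i < j ∧ hammingNorm (row i + row j) ≤ hammingNorm (row j) ∧
    hammingNorm (row i + row j) = hammingNorm (row i)

/-- `B`: the information indices whose row has minimum weight. -/
noncomputable def setB {n : ℕ} (I : Finset (Fin (2 ^ n))) : Finset (Fin (2 ^ n)) :=
  I.filter fun i => hammingNorm (row i) = minDist I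

/-- `B^c`: the frozen indices whose row has weight `w_min`. -/
noncomputable def setBc {n : ℕ} (I : Finset (Fin (2 ^ n))) : Finset (Fin (2 ^ n)) :=
  Iᶜ.filter fun i => hammingNorm (row i) = minDist I

/-- `E_j`: the indices `i < j` with `|S_i| = log₂ w_min` (written `2 ^ |S_i| = w_min`)
and `|S_j ∩ S_i| = |S_j| - 1`. -/
noncomputable def setE {n : ℕ} (I : Finset (Fin (2 ^ n))) (j : Fin (2 ^ n)) :
    Finset (Fin (2 ^ n)) :=
  Finset.univ.filter fun i => i < j ∧ 2 ^ (binSupp i).card = minDist I ∧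
    (binSupp j ∩ binSupp i).card + 1 = (binSupp j).card

/-- `D_j = E_j ∩ B`. -/
noncomputable def setD {n : ℕ} (I : Finset (Fin (2 ^ n))) (j : Fin (2 ^ n)) :
    Finset (Fin (2 ^ n)) :=
  setE I j ∩ setB I

end PolarCode

namespace PolarCode

/-! Describe a word by its coefficient vector in the rows, and call the smallest index occurring its
leading term. Write `r` for `|S_j|`, so that `w_min = 2 ^ r`. Since every index of `I` has at least
`r` bits, the minimum weight words of `C(I)` are minimum weight Reed–Muller words, and their leading
terms have exactly `r` bits (`isMin_of_leads`).

Two facts about such words with leading term `x` carry the proof. Their coefficients on `K_x` can be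
prescribed arbitrarily and determine the word (`exists_isMin`, `IsMin.ext`), so there are `2 ^
|K_x|` of them, half having a given coefficient at a chosen element of `K_x`. All their terms lie
above `x` in `≼` (`IsMin.PO`), so they belong to `C(I)` as soon as `x ∈ I`. Hence dropping `j`
destroys all words led by `j` and half of those led by each `x ∈ D_j`, while adding `i` creates at
most the half of the words led by `i` that avoid `j`.

Both facts come from the recursion `(u + v, v)` on the top bit, with `u` on the `lo` and `v` on the
`hi` indices. If `u ≠ 0`, minimality means that `u` is minimal and `v` is supported on `u`. Such `v`
are `u` times a combination of `1` and the indicators `y_a`, `a ∈ S_x` (`restrict`); they are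
parametrised by their coefficients at indices near `x` (`eq_zero_of_suppLE`,
`restrict_apply_of_near`). If `u = 0`, then `v` itself is minimal. -/

variable {n : ℕ}

/-! ### Splitting off the top bit of an index. -/

/-- The index obtained from `x` by adding a new top bit `0`. -/
def lo (x : Fin (2 ^ n)) : Fin (2 ^ (n + 1)) := pairEquiv n (0, x)

/-- The index obtained from `x` by adding a new top bit `1`. -/
def hi (x : Fin (2 ^ n)) : Fin (2 ^ (n + 1)) := pairEquiv n (1, x)

theorem val_lo (x : Fin (2 ^ n)) : (lo x).val = x.val := by
  simp [lo, pairEquiv, finProdFinEquiv]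

theorem val_hi (x : Fin (2 ^ n)) : (hi x).val = 2 ^ n + x.val := by
  simp [hi, pairEquiv, finProdFinEquiv, add_comm]

theorem lo_or_hi (x : Fin (2 ^ (n + 1))) : (∃ y, x = lo y) ∨ ∃ y, x = hi y := by
  obtain ⟨⟨a, y⟩, rfl⟩ := (pairEquiv n).surjective x
  fin_cases a
  · exact Or.inl ⟨y, rfl⟩
  · exact Or.inr ⟨y, rfl⟩

theorem forall_index {p : Fin (2 ^ (n + 1)) → Prop} :
    (∀ x, p x) ↔ (∀ y, p (lo y)) ∧ ∀ y, p (hi y) := by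
  refine ⟨fun h => ⟨fun y => h _, fun y => h _⟩, fun h x => ?_⟩
  rcases lo_or_hi x with ⟨y, rfl⟩ | ⟨y, rfl⟩
  exacts [h.1 y, h.2 y]

theorem sum_index {M : Type*} [AddCommMonoid M] (f : Fin (2 ^ (n + 1)) → M) :
    ∑ x, f x = ∑ y, f (lo y) + ∑ y, f (hi y) := by
  rw [← (pairEquiv n).sum_comp, Fintype.sum_prod_type, Fin.sum_univ_two]
  rfl

@[simp] theorem lo_lt_lo {x y : Fin (2 ^ n)} : lo x < lo y ↔ x < y := by
  simp only [Fin.lt_def, val_lo]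

@[simp] theorem hi_lt_hi {x y : Fin (2 ^ n)} : hi x < hi y ↔ x < y := by
  simp only [Fin.lt_def, val_hi, add_lt_add_iff_left]

@[simp] theorem lo_lt_hi (x y : Fin (2 ^ n)) : lo x < hi y := by
  simp only [Fin.lt_def, val_lo, val_hi]
  omega

@[simp] theorem not_hi_lt_lo (x y : Fin (2 ^ n)) : ¬ hi x < lo y :=
  (lo_lt_hi y x).not_gt

theorem mem_binSupp {x : Fin (2 ^ n)} {a : Fin n} :
    a ∈ binSupp x ↔ x.val.testBit a.val = true := by
  simp [binSupp]

theorem binSupp_lo (x : Fin (2 ^ n)) :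
    binSupp (lo x) = (binSupp x).map Fin.castSuccEmb := by
  ext a
  induction a using Fin.lastCases with
  | last => simp [mem_binSupp, val_lo, Nat.testBit_lt_two_pow x.isLt, Fin.castSucc_ne_last]
  | cast a => simp [mem_binSupp, val_lo]

theorem binSupp_hi (x : Fin (2 ^ n)) :
    binSupp (hi x) = insert (Fin.last n) ((binSupp x).map Fin.castSuccEmb) := by
  ext a
  induction a using Fin.lastCases with
  | last => simp [mem_binSupp, val_hi, Nat.testBit_two_pow_add_eq, Nat.testBit_lt_two_pow x.isLt]
  | cast a =>
    simp [mem_binSupp, val_hi, Nat.testBit_two_pow_add_gt a.isLt, Fin.castSucc_ne_last]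

theorem last_notMem_map (s : Finset (Fin n)) : Fin.last n ∉ s.map Fin.castSuccEmb := by
  simp [Fin.castSucc_ne_last]

@[simp] theorem card_lo (x : Fin (2 ^ n)) : (binSupp (lo x)).card = (binSupp x).card := by
  simp [binSupp_lo]

@[simp] theorem card_hi (x : Fin (2 ^ n)) : (binSupp (hi x)).card = (binSupp x).card + 1 := by
  rw [binSupp_hi, Finset.card_insert_of_notMem (last_notMem_map _), Finset.card_map]

@[simp] theorem lo_subset_lo {x y : Fin (2 ^ n)} :
    binSupp (lo x) ⊆ binSupp (lo y) ↔ binSupp x ⊆ binSupp y := by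
  simp [binSupp_lo]

@[simp] theorem lo_subset_hi {x y : Fin (2 ^ n)} :
    binSupp (lo x) ⊆ binSupp (hi y) ↔ binSupp x ⊆ binSupp y := by
  rw [binSupp_lo, binSupp_hi, Finset.subset_insert_iff_of_notMem (last_notMem_map _),
    Finset.map_subset_map]

@[simp] theorem hi_subset_hi {x y : Fin (2 ^ n)} :
    binSupp (hi x) ⊆ binSupp (hi y) ↔ binSupp x ⊆ binSupp y := by
  rw [← lo_subset_hi (x := x), binSupp_hi x, Finset.insert_subset_iff, ← binSupp_lo]
  simp [binSupp_hi]

@[simp] theorem not_hi_subset_lo (x y : Fin (2 ^ n)) :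
    ¬ binSupp (hi x) ⊆ binSupp (lo y) := by
  intro h
  rw [binSupp_lo, binSupp_hi] at h
  exact last_notMem_map _ (h (Finset.mem_insert_self _ _))

@[simp] theorem card_lo_inter_lo (x y : Fin (2 ^ n)) :
    (binSupp (lo x) ∩ binSupp (lo y)).card = (binSupp x ∩ binSupp y).card := by
  rw [binSupp_lo, binSupp_lo, ← Finset.map_inter, Finset.card_map]

@[simp] theorem card_lo_inter_hi (x y : Fin (2 ^ n)) :
    (binSupp (lo x) ∩ binSupp (hi y)).card = (binSupp x ∩ binSupp y).card := by
  rw [binSupp_lo, binSupp_hi, Finset.inter_insert_of_notMem (last_notMem_map _),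
    ← Finset.map_inter, Finset.card_map]

@[simp] theorem card_hi_inter_lo (x y : Fin (2 ^ n)) :
    (binSupp (hi x) ∩ binSupp (lo y)).card = (binSupp x ∩ binSupp y).card := by
  rw [Finset.inter_comm, card_lo_inter_hi, Finset.inter_comm]

@[simp] theorem card_hi_inter_hi (x y : Fin (2 ^ n)) :
    (binSupp (hi x) ∩ binSupp (hi y)).card = (binSupp x ∩ binSupp y).card + 1 := by
  rw [binSupp_hi, binSupp_hi, ← Finset.insert_inter_distrib, ← Finset.map_inter,
    Finset.card_insert_of_notMem (last_notMem_map _), Finset.card_map]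

theorem binSupp_injective : Function.Injective (binSupp (n := n)) := by
  intro x y h
  refine Fin.ext (Nat.eq_of_testBit_eq fun a => ?_)
  by_cases ha : a < n
  · have := congrArg (fun s => (⟨a, ha⟩ : Fin n) ∈ s) h
    simp only [mem_binSupp, eq_iff_iff] at this
    exact Bool.eq_iff_iff.2 this
  · have h2 : 2 ^ n ≤ 2 ^ a := Nat.pow_le_pow_right (by norm_num) (not_lt.mp ha)
    rw [Nat.testBit_lt_two_pow (x.isLt.trans_le h2), Nat.testBit_lt_two_pow (y.isLt.trans_le h2)]

theorem binSupp_surjective : Function.Surjective (binSupp (n := n)) :=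
  ((Fintype.bijective_iff_injective_and_card _).2 ⟨binSupp_injective, by simp⟩).2

/-! ### The rows of the polar transform -/

@[simp] theorem row_lo_lo (x y : Fin (2 ^ n)) : row (lo x) (lo y) = row x y := by
  simp [row, polarTransform, lo, kernel]

@[simp] theorem row_lo_hi (x y : Fin (2 ^ n)) : row (lo x) (hi y) = 0 := by
  simp [row, polarTransform, lo, hi, kernel]

@[simp] theorem row_hi_lo (x y : Fin (2 ^ n)) : row (hi x) (lo y) = row x y := by
  simp [row, polarTransform, lo, hi, kernel]

@[simp] theorem row_hi_hi (x y : Fin (2 ^ n)) : row (hi x) (hi y) = row x y := by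
  simp [row, polarTransform, hi, kernel]

theorem row_apply (x y : Fin (2 ^ n)) :
    row x y = if binSupp y ⊆ binSupp x then 1 else 0 := by
  induction n with
  | zero =>
    obtain rfl : x = y := Subsingleton.elim (α := Fin 1) x y
    simp [row, polarTransform]
  | succ n ih =>
    rcases lo_or_hi x with ⟨x, rfl⟩ | ⟨x, rfl⟩ <;> rcases lo_or_hi y with ⟨y, rfl⟩ | ⟨y, rfl⟩ <;>
      simp [ih]

theorem hammingNorm_index (f : Fin (2 ^ (n + 1)) → ZMod 2) :
    hammingNorm f = hammingNorm (fun y => f (lo y)) + hammingNorm fun y => f (hi y) := by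
  simp only [hammingNorm, Finset.card_filter]
  exact sum_index _

theorem hammingNorm_const_zero : hammingNorm (fun _ : Fin (2 ^ n) => (0 : ZMod 2)) = 0 :=
  hammingNorm_zero

theorem hammingNorm_row (x : Fin (2 ^ n)) : hammingNorm (row x) = 2 ^ (binSupp x).card := by
  induction n with
  | zero =>
    have : row x = fun _ => 1 := by
      funext y
      rw [row_apply, if_pos]
      exact fun a => a.elim0
    simp [this, hammingNorm, binSupp]
  | succ n ih =>
    rw [hammingNorm_index]
    rcases lo_or_hi x with ⟨x, rfl⟩ | ⟨x, rfl⟩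
    · simp only [row_lo_lo, row_lo_hi, card_lo, hammingNorm_const_zero]
      exact ih x
    · simp only [row_hi_lo, row_hi_hi, card_hi, pow_succ, mul_two]
      exact congrArg₂ _ (ih x) (ih x)

/-- The supports of the two rows meet in the columns `z` with `S_z ⊆ S_x ∩ S_y`, and these cancel in
the sum. The additive form avoids subtraction in `ℕ`. -/
theorem hammingNorm_row_add_row (x y : Fin (2 ^ n)) :
    hammingNorm (row x + row y) + 2 * 2 ^ (binSupp x ∩ binSupp y).card =
      2 ^ (binSupp x).card + 2 ^ (binSupp y).card := by
  induction n with
  | zero =>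
    obtain rfl : x = y := Subsingleton.elim (α := Fin 1) x y
    rw [CharTwo.add_self_eq_zero, hammingNorm_zero, Finset.inter_self]
    omega
  | succ n ih =>
    rw [hammingNorm_index]
    rcases lo_or_hi x with ⟨x, rfl⟩ | ⟨x, rfl⟩ <;>
    rcases lo_or_hi y with ⟨y, rfl⟩ | ⟨y, rfl⟩ <;>
    · have h := ih x y
      have hx := hammingNorm_row x
      have hy := hammingNorm_row y
      change hammingNorm (fun z => row x z + row y z) + _ = _ at h
      change hammingNorm (fun z => row x z) = _ at hx
      change hammingNorm (fun z => row y z) = _ at hy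
      simp [hx, hy, pow_succ, hammingNorm_const_zero] at h ⊢
      try omega

/-- By the weight formula for a sum of two rows, `w(g_x + g_y) = w(g_x)` says `2 * 2 ^ |S_x ∩ S_y| =
2 ^ |S_y|`. -/
theorem mem_setK {x y : Fin (2 ^ n)} :
    y ∈ setK x ↔ x < y ∧ (binSupp x).card ≤ (binSupp y).card ∧
      (binSupp x ∩ binSupp y).card + 1 = (binSupp y).card := by
  have h := hammingNorm_row_add_row x y
  have h2 : 2 * 2 ^ (binSupp x ∩ binSupp y).card = 2 ^ ((binSupp x ∩ binSupp y).card + 1) := by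
    ring
  have h3 : 2 ^ ((binSupp x ∩ binSupp y).card + 1) = 2 ^ (binSupp y).card ↔
    (binSupp x ∩ binSupp y).card + 1 = (binSupp y).card := (Nat.pow_right_injective le_rfl).eq_iff
  have h4 : 2 ^ (binSupp x).card ≤ 2 ^ (binSupp y).card ↔
    (binSupp x).card ≤ (binSupp y).card := Nat.pow_le_pow_iff_right (by norm_num)
  simp only [setK, Finset.mem_filter, Finset.mem_univ, true_and, hammingNorm_row]
  rw [← h3, ← h4]
  omega

@[simp] theorem lo_mem_setK_lo {x y : Fin (2 ^ n)} : lo y ∈ setK (lo x) ↔ y ∈ setK x := by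
  simp [mem_setK]

@[simp] theorem hi_mem_setK_hi {x y : Fin (2 ^ n)} : hi y ∈ setK (hi x) ↔ y ∈ setK x := by
  simp [mem_setK]

@[simp] theorem lo_notMem_setK_hi (x y : Fin (2 ^ n)) : lo y ∉ setK (hi x) := by
  simp [mem_setK]

/-- `y` is obtained from `x` by turning off at most one bit. -/
def Near (x y : Fin (2 ^ n)) : Prop :=
  binSupp y ⊆ binSupp x ∧ (binSupp x).card ≤ (binSupp y).card + 1

instance (x y : Fin (2 ^ n)) : Decidable (Near x y) := by
  unfold Near; infer_instance

-- This is the source of `Near`: the part of `K` gained when a top bit becomes available is exactly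
-- the set parametrising the `v` in `(u + v, v)`.
@[simp] theorem hi_mem_setK_lo {x y : Fin (2 ^ n)} : hi y ∈ setK (lo x) ↔ Near x y := by
  simp only [mem_setK, lo_lt_hi, card_lo, card_hi, card_lo_inter_hi, true_and, Near,
    add_left_inj, ← Finset.inter_eq_right]
  refine ⟨fun h => ⟨Finset.eq_of_subset_of_card_le Finset.inter_subset_right h.2.ge, h.1⟩,
    fun h => ⟨h.2, by rw [h.1]⟩⟩

/-! ### The partial order -/

theorem PO.refl (x : Fin (2 ^ n)) : PO x x := .subset subset_rfl

theorem PO.lo {x y : Fin (2 ^ n)} (h : PO x y) : PO (lo x) (lo y) := by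
  induction h with
  | subset h => exact .subset (lo_subset_lo.2 h)
  | @swap x y a b ha hb hab h =>
    refine .swap a.castSucc b.castSucc ?_ ?_ (by simpa using hab) ?_
    · simpa [binSupp_lo] using ha
    · simpa [binSupp_lo] using hb
    · rw [binSupp_lo, binSupp_lo, h, Finset.map_insert, Finset.map_erase]
      rfl
  | trans _ _ h1 h2 => exact .trans h1 h2

theorem PO.hi {x y : Fin (2 ^ n)} (h : PO x y) : PO (hi x) (hi y) := by
  induction h with
  | subset h => exact .subset (hi_subset_hi.2 h)
  | @swap x y a b ha hb hab h =>
    refine .swap a.castSucc b.castSucc ?_ ?_ (by simpa using hab) ?_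
    · simpa [binSupp_hi, Fin.castSucc_ne_last] using ha
    · simpa [binSupp_hi, Fin.castSucc_ne_last] using hb
    · rw [binSupp_hi, binSupp_hi, h, Finset.map_insert, Finset.map_erase,
        Finset.erase_insert_of_ne (Fin.castSucc_ne_last a).symm, Finset.insert_comm]
      rfl
  | trans _ _ h1 h2 => exact .trans h1 h2

/-- Either no bit is lost and the supports are nested, or the lost bit moves up to the top position,
which is a swap. -/
theorem PO.lo_hi {x y : Fin (2 ^ n)} (h : Near x y) : PO (PolarCode.lo x) (PolarCode.hi y) := by
  by_cases hxy : binSupp x ⊆ binSupp y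
  · exact .subset (lo_subset_hi.2 hxy)
  obtain ⟨a, ha, hay⟩ := Finset.not_subset.1 hxy
  have hy : binSupp y = (binSupp x).erase a := by
    refine Finset.eq_of_subset_of_card_le (Finset.subset_erase.2 ⟨h.1, hay⟩) ?_
    rw [Finset.card_erase_of_mem ha]
    have := h.2
    omega
  refine .swap a.castSucc (Fin.last n) ?_ ?_ (Fin.castSucc_lt_last a) ?_
  · simpa [binSupp_lo] using ha
  · rw [binSupp_lo]; exact last_notMem_map _
  · rw [binSupp_lo, binSupp_hi, hy, Finset.map_erase]
    rfl

/-! ### Coefficient vectors -/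

/-- The word `∑ h, c h • g_h` with coefficient vector `c`. -/
def ev (c : Fin (2 ^ n) → ZMod 2) (k : Fin (2 ^ n)) : ZMod 2 := ∑ h, c h * row h k

theorem ev_lo (c : Fin (2 ^ (n + 1)) → ZMod 2) (k : Fin (2 ^ n)) :
    ev c (lo k) = ev (fun h => c (lo h)) k + ev (fun h => c (hi h)) k := by
  simp [ev, sum_index]

theorem ev_hi (c : Fin (2 ^ (n + 1)) → ZMod 2) (k : Fin (2 ^ n)) :
    ev c (hi k) = ev (fun h => c (hi h)) k := by
  simp [ev, sum_index]

theorem ev_zero : ev (0 : Fin (2 ^ n) → ZMod 2) = 0 := by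
  funext k
  simp [ev]

theorem ev_add (c c' : Fin (2 ^ n) → ZMod 2) : ev (c + c') = ev c + ev c' := by
  funext k
  simp [ev, add_mul, Finset.sum_add_distrib]

theorem ev_single (x : Fin (2 ^ n)) : ev (Pi.single x 1) = row x := by
  funext k
  simp [ev, Pi.single_apply]

/-! ### Weights of `(u + v, v)` and the Reed–Muller minimum distance. -/

/-- All terms of `c` have at least `r` ones in their binary representation. -/
def SizeGE (r : ℕ) (c : Fin (2 ^ n) → ZMod 2) : Prop :=
  ∀ h, c h ≠ 0 → r ≤ (binSupp h).card

/-- The support of the word of `v` lies in the support of the word of `u`. -/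
def SuppLE (v u : Fin (2 ^ n) → ZMod 2) : Prop :=
  ∀ k, ev u k = 0 → ev v k = 0

theorem zmod_two_cases (a : ZMod 2) : a = 0 ∨ a = 1 := by
  revert a
  decide

theorem zmod_two_eq_one {a : ZMod 2} (h : a ≠ 0) : a = 1 :=
  (zmod_two_cases a).resolve_left h

theorem hammingNorm_add_add (u v : Fin (2 ^ n) → ZMod 2) :
    hammingNorm (u + v) + hammingNorm v =
      hammingNorm u + 2 * (Finset.univ.filter fun k => u k = 0 ∧ v k ≠ 0).card := by
  simp only [hammingNorm, Finset.card_filter, Finset.mul_sum, ← Finset.sum_add_distrib]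
  refine Finset.sum_congr rfl fun k _ => ?_
  rw [Pi.add_apply]
  rcases zmod_two_cases (u k) with h | h <;> rcases zmod_two_cases (v k) with h' | h' <;>
    simp [h, h', CharTwo.add_self_eq_zero]

/-- The weight of `(u + v, v)`. -/
theorem hammingNorm_ev_index (c : Fin (2 ^ (n + 1)) → ZMod 2) :
    hammingNorm (ev c) = hammingNorm (ev fun h => c (lo h)) + 2 * (Finset.univ.filter fun k =>
      ev (fun h => c (lo h)) k = 0 ∧ ev (fun h => c (hi h)) k ≠ 0).card := by
  rw [hammingNorm_index, ← hammingNorm_add_add]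
  simp only [ev_lo, ev_hi]
  rfl

theorem hammingNorm_ev_of_lo_eq_zero {c : Fin (2 ^ (n + 1)) → ZMod 2}
    (h0 : (fun h => c (lo h)) = 0) :
    hammingNorm (ev c) = 2 * hammingNorm (ev fun h => c (hi h)) := by
  rw [hammingNorm_ev_index, h0, ev_zero, hammingNorm_zero, zero_add]
  simp [hammingNorm]

theorem SizeGE.lo {r : ℕ} {c : Fin (2 ^ (n + 1)) → ZMod 2} (h : SizeGE r c) :
    SizeGE r fun x => c (lo x) := fun x hx => by
  simpa using h _ hx

theorem SizeGE.hi {r : ℕ} {c : Fin (2 ^ (n + 1)) → ZMod 2} (h : SizeGE r c) :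
    SizeGE (r - 1) fun x => c (hi x) := fun x hx => by
  have := h _ hx
  rw [card_hi] at this
  omega

theorem eq_zero_index {c : Fin (2 ^ (n + 1)) → ZMod 2}
    (h0 : (fun h => c (lo h)) = 0) (h1 : (fun h => c (hi h)) = 0) : c = 0 := by
  funext x
  rcases lo_or_hi x with ⟨x, rfl⟩ | ⟨x, rfl⟩
  exacts [congrFun h0 x, congrFun h1 x]

/-- The minimum distance of Reed–Muller codes. -/
theorem two_pow_le_hammingNorm_ev {r : ℕ} {c : Fin (2 ^ n) → ZMod 2} (hc : c ≠ 0)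
    (hr : SizeGE r c) : 2 ^ r ≤ hammingNorm (ev c) := by
  induction n generalizing r with
  | zero =>
    obtain ⟨x, hx⟩ := Function.ne_iff.1 hc
    have h0 : r = 0 := by simpa [binSupp] using hr x hx
    have h1 : 2 ^ r = 1 := by rw [h0, pow_zero]
    refine h1.trans_le (Nat.one_le_iff_ne_zero.2 fun h => ?_)
    rw [hammingNorm_eq_zero] at h
    have := congrFun h x
    rw [ev, Fintype.sum_eq_single x fun y hy => (hy (Subsingleton.elim (α := Fin 1) y x)).elim,
      row_apply, if_pos subset_rfl, mul_one] at this
    exact hx this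
  | succ n ih =>
    by_cases h0 : (fun h => c (lo h)) = 0
    · rw [hammingNorm_ev_of_lo_eq_zero h0]
      have := ih (fun h1 => hc (eq_zero_index h0 h1)) hr.hi
      -- Only an inequality, because truncated subtraction gives `r - 1 + 1 = 1` when `r = 0`.
      calc 2 ^ r ≤ 2 ^ (r - 1 + 1) := Nat.pow_le_pow_right (by norm_num) (by omega)
        _ ≤ _ := by rw [pow_succ]; omega
    · have := ih h0 hr.lo
      rw [hammingNorm_ev_index]
      omega

theorem eq_zero_of_ev_eq_zero {c : Fin (2 ^ n) → ZMod 2} (h : ev c = 0) : c = 0 := by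
  by_contra hc
  have := two_pow_le_hammingNorm_ev (r := 0) hc fun _ _ => Nat.zero_le _
  simp [h] at this

theorem ev_injective : Function.Injective (ev (n := n)) := by
  intro c c' h
  have : ev (c + c') = 0 := by rw [ev_add, h, CharTwo.add_self_eq_zero]
  exact CharTwo.add_eq_zero.1 (eq_zero_of_ev_eq_zero this)

/-! ### Minimum weight words with a given leading term -/

/-- `x` is the smallest index in the support of `c`. -/
def Leads (x : Fin (2 ^ n)) (c : Fin (2 ^ n) → ZMod 2) : Prop :=
  c x = 1 ∧ ∀ h < x, c h = 0

/-- `c` is the coefficient vector of a minimum weight word of a Reed–Muller code with leading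
term `x`. -/
def IsMin (x : Fin (2 ^ n)) (c : Fin (2 ^ n) → ZMod 2) : Prop :=
  Leads x c ∧ SizeGE (binSupp x).card c ∧ hammingNorm (ev c) = 2 ^ (binSupp x).card

theorem exists_leads {c : Fin (2 ^ n) → ZMod 2} (hc : c ≠ 0) : ∃ x, Leads x c := by
  obtain ⟨y, hy⟩ := Function.ne_iff.1 hc
  obtain ⟨x, hx, hmin⟩ := WellFounded.has_min (wellFounded_lt (α := Fin (2 ^ n)))
    {z | c z ≠ 0} ⟨y, hy⟩
  exact ⟨x, zmod_two_eq_one hx, fun h hh => by_contra fun h' => hmin h h' hh⟩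

theorem Leads.ne_zero {x : Fin (2 ^ n)} {c : Fin (2 ^ n) → ZMod 2} (h : Leads x c) : c ≠ 0 := by
  rintro rfl
  exact zero_ne_one h.1

theorem Leads.unique {x y : Fin (2 ^ n)} {c : Fin (2 ^ n) → ZMod 2} (hx : Leads x c)
    (hy : Leads y c) : x = y := by
  rcases lt_trichotomy x y with h | h | h
  · exact absurd (hx.1.symm.trans (hy.2 x h)) one_ne_zero
  · exact h
  · exact absurd (hy.1.symm.trans (hx.2 y h)) one_ne_zero

theorem leads_lo {x : Fin (2 ^ n)} {c : Fin (2 ^ (n + 1)) → ZMod 2} :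
    Leads (lo x) c ↔ Leads x fun h => c (lo h) := by
  simp [Leads, forall_index]

theorem leads_hi {x : Fin (2 ^ n)} {c : Fin (2 ^ (n + 1)) → ZMod 2} :
    Leads (hi x) c ↔ (fun h => c (lo h)) = 0 ∧ Leads x fun h => c (hi h) := by
  simp [Leads, forall_index, funext_iff]
  tauto

theorem sizeGE_index {r : ℕ} {c : Fin (2 ^ (n + 1)) → ZMod 2} :
    SizeGE r c ↔ SizeGE r (fun h => c (lo h)) ∧
      ∀ h, c (hi h) ≠ 0 → r ≤ (binSupp h).card + 1 := by
  simp [SizeGE, forall_index]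

/-- With `u = 0` the word is `(v, v)`: its weight doubles, matching the extra bit of the leading
term. -/
theorem isMin_hi {x : Fin (2 ^ n)} {c : Fin (2 ^ (n + 1)) → ZMod 2} :
    IsMin (hi x) c ↔ (fun h => c (lo h)) = 0 ∧ IsMin x fun h => c (hi h) := by
  rw [IsMin, leads_hi, sizeGE_index, and_assoc]
  refine and_congr_right fun h0 => ?_
  rw [hammingNorm_ev_of_lo_eq_zero h0, h0, IsMin, card_hi, pow_succ', mul_right_inj' two_ne_zero]
  simp [SizeGE]

/-- The weight of `u` is already at least `2 ^ |S_x|`, so equality forces the excess `2 * |supp v \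
supp u|` to vanish. -/
theorem isMin_lo {x : Fin (2 ^ n)} {c : Fin (2 ^ (n + 1)) → ZMod 2} :
    IsMin (lo x) c ↔ IsMin x (fun h => c (lo h)) ∧
      SuppLE (fun h => c (hi h)) (fun h => c (lo h)) ∧
      ∀ h, c (hi h) ≠ 0 → (binSupp x).card ≤ (binSupp h).card + 1 := by
  rw [IsMin, leads_lo, sizeGE_index, hammingNorm_ev_index, card_lo, IsMin]
  have hS : SuppLE (fun h => c (hi h)) (fun h => c (lo h)) ↔ (Finset.univ.filter fun k =>
      ev (fun h => c (lo h)) k = 0 ∧ ev (fun h => c (hi h)) k ≠ 0).card = 0 := by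
    simp [SuppLE, Finset.filter_eq_empty_iff]
  rw [hS]
  constructor
  · rintro ⟨hl, ⟨hs, hh⟩, hw⟩
    have := two_pow_le_hammingNorm_ev hl.ne_zero hs
    exact ⟨⟨hl, hs, by omega⟩, by omega, hh⟩
  · rintro ⟨⟨hl, hs, hw⟩, h0, hh⟩
    exact ⟨hl, ⟨hs, hh⟩, by omega⟩

/-- A minimum weight word has a leading term of minimum weight. -/
theorem isMin_of_leads {r : ℕ} {x : Fin (2 ^ n)} {c : Fin (2 ^ n) → ZMod 2} (hx : Leads x c)
    (hr : SizeGE r c) (hw : hammingNorm (ev c) = 2 ^ r) :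
    (binSupp x).card = r ∧ IsMin x c := by
  suffices h : (binSupp x).card = r from ⟨h, hx, h ▸ hr, h ▸ hw⟩
  have hxr : r ≤ (binSupp x).card := hr x (by rw [hx.1]; exact one_ne_zero)
  induction n generalizing r with
  | zero =>
    have : (binSupp x).card = 0 := by simp [binSupp]
    omega
  | succ n ih =>
    rcases lo_or_hi x with ⟨x, rfl⟩ | ⟨x, rfl⟩
    · rw [leads_lo] at hx
      rw [card_lo] at hxr ⊢
      refine ih hx hr.lo ?_ hxr
      have := two_pow_le_hammingNorm_ev hx.ne_zero hr.lo
      rw [hammingNorm_ev_index] at hw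
      omega
    · rw [leads_hi] at hx
      rw [hammingNorm_ev_of_lo_eq_zero hx.1] at hw
      rw [card_hi] at hxr ⊢
      -- For `r = 0` the even weight of `(v, v)` would equal `1`.
      obtain _ | r := r
      · omega
      · rw [pow_succ] at hw
        rw [ih hx.2 hr.hi (by rw [Nat.add_sub_cancel]; omega) (by omega)]
        rfl

/-! ### Words supported on a minimum weight word. -/

theorem near_lo_lo {x y : Fin (2 ^ n)} : Near (lo x) (lo y) ↔ Near x y := by
  simp [Near]

theorem near_hi_hi {x y : Fin (2 ^ n)} : Near (hi x) (hi y) ↔ Near x y := by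
  simp [Near]

theorem near_hi_lo {x y : Fin (2 ^ n)} : Near (hi x) (lo y) ↔ x = y := by
  simp only [Near, lo_subset_hi, card_hi, card_lo, add_le_add_iff_right]
  refine ⟨fun h => binSupp_injective (Finset.eq_of_subset_of_card_le h.1 h.2).symm, ?_⟩
  rintro rfl
  exact ⟨subset_rfl, le_rfl⟩

theorem near_self (x : Fin (2 ^ n)) : Near x x := ⟨subset_rfl, Nat.le_succ _⟩

theorem Near.eq_of_card_le {x y : Fin (2 ^ n)} (h : Near x y)
    (hc : (binSupp x).card ≤ (binSupp y).card) : x = y :=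
  binSupp_injective (Finset.eq_of_subset_of_card_le h.1 hc).symm

/-- A word of degree at most one more, supported on a minimum weight word with leading term `x`,
is determined by its coefficients at the indices near `x`. -/
theorem eq_zero_of_suppLE {x : Fin (2 ^ n)} {u v : Fin (2 ^ n) → ZMod 2} (hu : IsMin x u)
    (hv : ∀ h, v h ≠ 0 → (binSupp x).card ≤ (binSupp h).card + 1) (hvu : SuppLE v u)
    (h0 : ∀ k, Near x k → v k = 0) : v = 0 := by
  induction n with
  | zero =>
    funext k
    obtain rfl : x = k := Subsingleton.elim (α := Fin 1) x k
    exact h0 x (near_self x)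
  | succ n ih =>
    rcases lo_or_hi x with ⟨x, rfl⟩ | ⟨x, rfl⟩
    · rw [isMin_lo] at hu
      have hlo : (fun h => v (lo h)) = 0 := by
        refine ih hu.1 (fun h hh => by simpa using hv (lo h) hh) (fun k hk => ?_)
          fun k hk => h0 _ (near_lo_lo.2 hk)
        -- Where the `lo` part of `u` vanishes, so does its `hi` part; thus both halves of `v`
        -- vanish there, and the `lo` part of `v` is supported on that of `u`.
        have h1 := hu.2.1 k hk
        have h2 := hvu (hi k) (by rw [ev_hi, h1])
        have h3 := hvu (lo k) (by rw [ev_lo, hk, h1, add_zero])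
        rwa [ev_lo, ← ev_hi, h2, add_zero] at h3
      -- Now `v` has two equal halves, while the halves of `u` have disjoint supports because its
      -- `hi` part is supported on its `lo` part. Hence `v = 0`.
      refine eq_zero_index hlo (eq_zero_of_ev_eq_zero (funext fun k => ?_))
      by_cases hk : ev (fun h => u (hi h)) k = 0
      · rw [← ev_hi]
        exact hvu (hi k) (by rw [ev_hi, hk])
      · have hk' : ev (fun h => u (lo h)) k ≠ 0 := fun h => hk (hu.2.1 k h)
        have h3 := hvu (lo k) (by
          rw [ev_lo, zmod_two_eq_one hk, zmod_two_eq_one hk']; rfl)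
        rwa [ev_lo, hlo, ev_zero, Pi.zero_apply, zero_add] at h3
    · rw [isMin_hi] at hu
      have key : ∀ k, ev (fun h => u (hi h)) k = 0 →
          ev (fun h => v (lo h)) k = 0 ∧ ev (fun h => v (hi h)) k = 0 := by
        intro k hk
        have h2 := hvu (hi k) (by rw [ev_hi, hk])
        have h3 := hvu (lo k) (by rw [ev_lo, hu.1, ev_zero, hk]; rfl)
        rw [ev_hi] at h2
        rw [ev_lo, h2, add_zero] at h3
        exact ⟨h3, h2⟩
      refine eq_zero_index ?_ ?_
      -- The leading term has one bit more than `x`, so the size bound on the `lo` part improves by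
      -- one, and `x` is the only index near `x` left to check.
      · have hs : ∀ h, v (lo h) ≠ 0 → (binSupp x).card ≤ (binSupp h).card := fun h hh => by
          simpa using hv (lo h) hh
        refine ih hu.2 (fun h hh => (hs h hh).trans (Nat.le_succ _)) (fun k hk => (key k hk).1)
          fun k hk => by_contra fun hne => hne ?_
        rw [← hk.eq_of_card_le (hs k hne)]
        exact h0 _ (near_hi_lo.2 rfl)
      · exact ih hu.2 (fun h hh => by simpa using hv (hi h) hh) (fun k hk => (key k hk).2)
          fun k hk => h0 _ (near_hi_hi.2 hk)

/-- The index whose binary support is `S_h \ (S_x \ S_k)`. -/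
noncomputable def turnOff (x k h : Fin (2 ^ n)) : Fin (2 ^ n) :=
  (binSupp_surjective (binSupp h \ (binSupp x \ binSupp k))).choose

theorem binSupp_turnOff (x k h : Fin (2 ^ n)) :
    binSupp (turnOff x k h) = binSupp h \ (binSupp x \ binSupp k) :=
  (binSupp_surjective (binSupp h \ (binSupp x \ binSupp k))).choose_spec

theorem near_turnOff {x k : Fin (2 ^ n)} (hk : Near x k) (h : Fin (2 ^ n)) :
    Near h (turnOff x k h) := by
  rw [Near, binSupp_turnOff]
  refine ⟨Finset.sdiff_subset, ?_⟩
  have h1 := Finset.le_card_sdiff (binSupp x \ binSupp k) (binSupp h)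
  have h2 := Finset.card_sdiff_add_card_eq_card hk.1
  have := hk.2
  omega

/-- The coefficient vector of `∑ φ k • u * ∏ y_a`, where `k` runs over the indices near `x` and
`a` over `S_x \ S_k`, and `y_a` is the indicator of the columns whose bit `a` is `0`. -/
noncomputable def restrict (x : Fin (2 ^ n)) (u φ : Fin (2 ^ n) → ZMod 2) (m : Fin (2 ^ n)) :
    ZMod 2 :=
  ∑ k with Near x k, φ k * ∑ h with turnOff x k h = m, u h

theorem exists_of_restrict_ne_zero {x : Fin (2 ^ n)} {u φ : Fin (2 ^ n) → ZMod 2}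
    {m : Fin (2 ^ n)} (hm : restrict x u φ m ≠ 0) : ∃ h, u h ≠ 0 ∧ Near h m := by
  obtain ⟨k, hk, hk'⟩ := Finset.exists_ne_zero_of_sum_ne_zero hm
  obtain ⟨h, hh, hh'⟩ := Finset.exists_ne_zero_of_sum_ne_zero (right_ne_zero_of_mul hk')
  simp only [Finset.mem_filter, Finset.mem_univ, true_and] at hk hh
  exact ⟨h, hh', hh ▸ near_turnOff hk h⟩

/-- Switching bits off in the index multiplies the row by the corresponding `y_a`. -/
theorem row_turnOff (x k h m : Fin (2 ^ n)) :
    row (turnOff x k h) m =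
      row h m * if Disjoint (binSupp m) (binSupp x \ binSupp k) then 1 else 0 := by
  simp only [row_apply, binSupp_turnOff, Finset.subset_sdiff, ite_and, mul_ite, mul_one, mul_zero]
  split_ifs <;> rfl

theorem suppLE_restrict (x : Fin (2 ^ n)) (u φ : Fin (2 ^ n) → ZMod 2) :
    SuppLE (restrict x u φ) u := by
  intro m hm
  -- After exchanging the sums, the word is `u` multiplied pointwise by a function of the column.
  have : ev (restrict x u φ) m = ∑ k with Near x k, φ k * (ev u m *
      if Disjoint (binSupp m) (binSupp x \ binSupp k) then 1 else 0) := by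
    simp only [ev, restrict, Finset.sum_mul]
    rw [Finset.sum_comm]
    refine Finset.sum_congr rfl fun k _ => ?_
    simp only [mul_assoc, ← Finset.mul_sum]
    congr 1
    simp only [← row_turnOff]
    rw [← Finset.sum_fiberwise Finset.univ (turnOff x k) fun h => u h * row (turnOff x k h) m]
    refine Finset.sum_congr rfl fun l _ => ?_
    rw [Finset.sum_mul]
    refine Finset.sum_congr rfl fun h hh => ?_
    rw [(Finset.mem_filter.1 hh).2]
  rw [this, hm]
  simp

/-- Only the pair `k = m`, `h = x` contributes: the size bound on the terms of `u` excludes all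
others, so the coefficients near `x` are free. -/
theorem restrict_apply_of_near {x : Fin (2 ^ n)} {u φ : Fin (2 ^ n) → ZMod 2} (hu : IsMin x u)
    {m : Fin (2 ^ n)} (hm : Near x m) : restrict x u φ m = φ m := by
  rw [restrict, Finset.sum_eq_single m]
  · rw [Finset.sum_eq_single x, hu.1.1, mul_one]
    · intro h hh hne
      by_contra hu0
      have hc := hu.2.1 h hu0
      have hs := congrArg binSupp (Finset.mem_filter.1 hh).2
      rw [binSupp_turnOff] at hs
      -- A bit of `h` outside `S_x` is never switched off, so it would survive in `m`; hence `S_h ⊆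
      -- S_x`, and the size bound gives `h = x`.
      refine hne (binSupp_injective (Finset.eq_of_subset_of_card_le ?_ hc))
      intro a ha
      by_contra hax
      exact hax (hm.1 (hs ▸ Finset.mem_sdiff.2 ⟨ha, fun h' => hax (Finset.mem_sdiff.1 h').1⟩))
    · intro h
      refine (h ?_).elim
      refine Finset.mem_filter.2 ⟨Finset.mem_univ _, binSupp_injective ?_⟩
      rw [binSupp_turnOff, Finset.sdiff_sdiff_eq_self hm.1]
  · intro k hk hkm
    have hk := (Finset.mem_filter.1 hk).2
    refine mul_eq_zero_of_right _ (Finset.sum_eq_zero fun h hh => ?_)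
    by_contra hu0
    have hc := hu.2.1 h hu0
    have hs := congrArg binSupp (Finset.mem_filter.1 hh).2
    rw [binSupp_turnOff] at hs
    have hmk : binSupp m ⊆ binSupp k := by
      intro a ha
      by_contra hak
      have := hs ▸ ha
      exact (Finset.mem_sdiff.1 this).2 (Finset.mem_sdiff.2 ⟨hm.1 ha, hak⟩)
    have hlt : (binSupp m).card < (binSupp k).card :=
      Finset.card_lt_card (hmk.ssubset_of_ne fun h' => hkm (binSupp_injective h').symm)
    -- `S_m` is strictly inside `S_k` and misses at most one bit of `S_x`, which leaves `k = x`.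
    -- Then nothing is switched off, so `h = m` is too small to be a term of `u`.
    have hkx : x = k := hk.eq_of_card_le (by have := hm.2; omega)
    subst hkx
    rw [Finset.sdiff_self, Finset.sdiff_empty] at hs
    rw [hs] at hc
    omega
  · intro h
    exact (h (Finset.mem_filter.2 ⟨Finset.mem_univ _, hm⟩)).elim

theorem card_le_of_restrict_ne_zero {x : Fin (2 ^ n)} {u φ : Fin (2 ^ n) → ZMod 2}
    (hu : IsMin x u) {m : Fin (2 ^ n)} (hm : restrict x u φ m ≠ 0) :
    (binSupp x).card ≤ (binSupp m).card + 1 := by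
  obtain ⟨h, hh, hn⟩ := exists_of_restrict_ne_zero hm
  exact (hu.2.1 h hh).trans hn.2

theorem eq_of_suppLE {x : Fin (2 ^ n)} {u v w : Fin (2 ^ n) → ZMod 2} (hu : IsMin x u)
    (hv : ∀ h, v h ≠ 0 → (binSupp x).card ≤ (binSupp h).card + 1) (hvu : SuppLE v u)
    (hw : ∀ h, w h ≠ 0 → (binSupp x).card ≤ (binSupp h).card + 1) (hwu : SuppLE w u)
    (h0 : ∀ k, Near x k → v k = w k) : v = w := by
  refine CharTwo.add_eq_zero.1 (eq_zero_of_suppLE hu (fun h hh => ?_) (fun k hk => ?_)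
    fun k hk => CharTwo.add_eq_zero.2 (h0 k hk))
  · by_cases h1 : v h = 0
    · by_cases h2 : w h = 0
      · simp [h1, h2] at hh
      · exact hw h h2
    · exact hv h h1
  · rw [ev_add, Pi.add_apply, hvu k hk, hwu k hk, add_zero]

theorem eq_restrict {x : Fin (2 ^ n)} {u v : Fin (2 ^ n) → ZMod 2} (hu : IsMin x u)
    (hv : ∀ h, v h ≠ 0 → (binSupp x).card ≤ (binSupp h).card + 1) (hvu : SuppLE v u) :
    v = restrict x u v :=
  eq_of_suppLE hu hv hvu (fun _ hh => card_le_of_restrict_ne_zero hu hh) (suppLE_restrict x u v)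
    fun _ hk => (restrict_apply_of_near hu hk).symm

/-! ### Terms and free coefficients of minimum weight words. -/

/-- All terms of a minimum weight word lie above its leading term. -/
theorem IsMin.PO {x : Fin (2 ^ n)} {c : Fin (2 ^ n) → ZMod 2} (hc : IsMin x c) {h : Fin (2 ^ n)}
    (hh : c h ≠ 0) : PO x h := by
  induction n with
  | zero =>
    obtain rfl : x = h := Subsingleton.elim (α := Fin 1) x h
    exact .refl x
  | succ n ih =>
    rcases lo_or_hi x with ⟨x, rfl⟩ | ⟨x, rfl⟩
    · rw [isMin_lo] at hc
      rcases lo_or_hi h with ⟨h, rfl⟩ | ⟨h, rfl⟩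
      · exact (ih hc.1 hh).lo
      · have hr := congrFun (eq_restrict hc.1 hc.2.2 hc.2.1) h
        rw [hr] at hh
        obtain ⟨k, hk, hn⟩ := exists_of_restrict_ne_zero hh
        exact (ih hc.1 hk).lo.trans (.lo_hi hn)
    · rw [isMin_hi] at hc
      rcases lo_or_hi h with ⟨h, rfl⟩ | ⟨h, rfl⟩
      · exact (hh (congrFun hc.1 h)).elim
      · exact (ih hc.2 hh).hi

/-- The minimum weight words with leading term `x` have arbitrary coefficients on `K_x`. -/
theorem exists_isMin (x : Fin (2 ^ n)) (φ : Fin (2 ^ n) → ZMod 2) :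
    ∃ c, IsMin x c ∧ ∀ k ∈ setK x, c k = φ k := by
  induction n with
  | zero =>
    refine ⟨Pi.single x 1, ⟨⟨by simp, fun h hh => ?_⟩, fun h hh => ?_, ?_⟩, fun k hk => ?_⟩
    · exact (hh.ne (Subsingleton.elim (α := Fin 1) h x)).elim
    · rw [Subsingleton.elim (α := Fin 1) x h]
    · rw [ev_single, hammingNorm_row]
    · exact ((mem_setK.1 hk).1.ne (Subsingleton.elim (α := Fin 1) x k)).elim
  | succ n ih =>
    have join : ∀ u v : Fin (2 ^ n) → ZMod 2, ∃ c : Fin (2 ^ (n + 1)) → ZMod 2,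
        (fun h => c (lo h)) = u ∧ (fun h => c (hi h)) = v := by
      intro u v
      refine ⟨fun z => if ((pairEquiv n).symm z).1 = 0 then u ((pairEquiv n).symm z).2
        else v ((pairEquiv n).symm z).2, ?_, ?_⟩ <;> funext h <;> simp [lo, hi]
    rcases lo_or_hi x with ⟨x, rfl⟩ | ⟨x, rfl⟩
    · obtain ⟨u, hu, huK⟩ := ih x fun h => φ (lo h)
      obtain ⟨c, hc, hc'⟩ := join u (restrict x u fun h => φ (hi h))
      refine ⟨c, isMin_lo.2 ?_, ?_⟩
      · have hc'' := congrFun hc'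
        rw [hc, hc']
        exact ⟨hu, suppLE_restrict _ _ _, fun h hh =>
          card_le_of_restrict_ne_zero hu (hc'' h ▸ hh)⟩
      · rw [forall_index]
        refine ⟨fun y hy => (congrFun hc y).trans (huK y (lo_mem_setK_lo.1 hy)), fun y hy => ?_⟩
        exact (congrFun hc' y).trans (restrict_apply_of_near hu (hi_mem_setK_lo.1 hy))
    · obtain ⟨v, hv, hvK⟩ := ih x fun h => φ (hi h)
      obtain ⟨c, hc, hc'⟩ := join 0 v
      refine ⟨c, isMin_hi.2 ⟨hc, hc' ▸ hv⟩, ?_⟩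
      rw [forall_index]
      exact ⟨fun y hy => (lo_notMem_setK_hi x y hy).elim,
        fun y hy => (congrFun hc' y).trans (hvK y (hi_mem_setK_hi.1 hy))⟩

/-- A minimum weight word with leading term `x` is determined by its coefficients on `K_x`. -/
theorem IsMin.ext {x : Fin (2 ^ n)} {c c' : Fin (2 ^ n) → ZMod 2} (hc : IsMin x c)
    (hc' : IsMin x c') (h : ∀ k ∈ setK x, c k = c' k) : c = c' := by
  induction n with
  | zero =>
    funext k
    rw [Subsingleton.elim (α := Fin 1) k x, hc.1.1, hc'.1.1]
  | succ n ih =>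
    rw [forall_index] at h
    rcases lo_or_hi x with ⟨x, rfl⟩ | ⟨x, rfl⟩
    · rw [isMin_lo] at hc hc'
      have h1 := ih hc.1 hc'.1 fun k hk => h.1 k (lo_mem_setK_lo.2 hk)
      -- Once the `lo` parts agree, both `hi` parts are supported on the same minimal word.
      rw [← h1] at hc'
      have h2 := eq_of_suppLE hc.1 hc.2.2 hc.2.1 hc'.2.2 hc'.2.1
        fun k hk => h.2 k (hi_mem_setK_lo.2 hk)
      exact funext (forall_index.2 ⟨congrFun h1, congrFun h2⟩)
    · rw [isMin_hi] at hc hc'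
      have h2 := ih hc.2 hc'.2 fun k hk => h.2 k (hi_mem_setK_hi.2 hk)
      exact funext (forall_index.2 ⟨congrFun (hc.1.trans hc'.1.symm), congrFun h2⟩)

/-! ### Counting minimum weight words -/

theorem ncard_isMin_of_subset (x : Fin (2 ^ n)) {T : Finset (Fin (2 ^ n))} (hT : T ⊆ setK x)
    (ψ : Fin (2 ^ n) → ZMod 2) :
    {c | IsMin x c ∧ ∀ k ∈ setK x, k ∉ T → c k = ψ k}.ncard = 2 ^ T.card := by
  let F : {c | IsMin x c ∧ ∀ k ∈ setK x, k ∉ T → c k = ψ k} → T → ZMod 2 := fun c k => c.1 k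
  have hF : Function.Bijective F := by
    constructor
    · rintro ⟨c, hc, hcψ⟩ ⟨c', hc', hcψ'⟩ h
      refine Subtype.ext (hc.ext hc' fun k hk => ?_)
      by_cases hkT : k ∈ T
      · exact congrFun h ⟨k, hkT⟩
      · exact (hcψ k hk hkT).trans (hcψ' k hk hkT).symm
    · intro φ
      obtain ⟨c, hc, hcφ⟩ := exists_isMin x fun k => if h : k ∈ T then φ ⟨k, h⟩ else ψ k
      refine ⟨⟨c, hc, fun k hk hkT => ?_⟩, funext fun k => ?_⟩
      · rw [hcφ k hk, dif_neg hkT]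
      · exact (hcφ k (hT k.2)).trans (dif_pos k.2)
  rw [← Nat.card_coe_set_eq, Nat.card_congr (Equiv.ofBijective F hF)]
  simp

theorem ncard_isMin (x : Fin (2 ^ n)) : {c | IsMin x c}.ncard = 2 ^ (setK x).card := by
  rw [← ncard_isMin_of_subset x subset_rfl 0]
  congr 1
  ext c
  simp only [Set.mem_ofPred_eq, iff_self_and]
  exact fun _ k hk hk' => (hk' hk).elim

theorem ncard_isMin_coeff {x y : Fin (2 ^ n)} (hy : y ∈ setK x) (a : ZMod 2) :
    {c | IsMin x c ∧ c y = a}.ncard = 2 ^ ((setK x).card - 1) := by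
  rw [← Finset.card_erase_of_mem hy,
    ← ncard_isMin_of_subset x (Finset.erase_subset y (setK x)) fun _ => a]
  congr 1
  ext c
  refine and_congr_right fun _ => ⟨fun h k hk hk' => ?_, fun h => h y hy (by simp)⟩
  rw [Finset.mem_erase, not_and_or, not_not] at hk'
  exact (hk'.resolve_right (not_not.2 hk)) ▸ h

/-! ### Codes -/

theorem mem_code {I : Finset (Fin (2 ^ n))} {f : Fin (2 ^ n) → ZMod 2} :
    f ∈ code I ↔ ∃ c, (∀ h ∉ I, c h = 0) ∧ ev c = f := by
  constructor
  · intro hf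
    induction hf using Submodule.span_induction with
    | mem f hf =>
      obtain ⟨x, hx, rfl⟩ := hf
      refine ⟨Pi.single x 1, fun h hh => Pi.single_eq_of_ne ?_ _, ev_single x⟩
      rintro rfl
      exact hh hx
    | zero => exact ⟨0, fun _ _ => rfl, ev_zero⟩
    | add f g _ _ hf hg =>
      obtain ⟨c, hc, rfl⟩ := hf
      obtain ⟨d, hd, rfl⟩ := hg
      exact ⟨c + d, fun h hh => by rw [Pi.add_apply, hc h hh, hd h hh, add_zero], ev_add c d⟩
    | smul a f _ hf =>
      obtain ⟨c, hc, rfl⟩ := hf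
      rcases zmod_two_cases a with rfl | rfl
      · exact ⟨0, fun _ _ => rfl, by rw [ev_zero, zero_smul]⟩
      · exact ⟨c, hc, (one_smul _ _).symm⟩
  · rintro ⟨c, hc, rfl⟩
    have : ev c = ∑ h, c h • row h := by
      funext k
      simp [ev]
    rw [this]
    refine Submodule.sum_mem _ fun h _ => ?_
    by_cases hh : h ∈ I
    · exact Submodule.smul_mem _ _ (Submodule.subset_span ⟨h, hh, rfl⟩)
    · rw [hc h hh, zero_smul]
      exact Submodule.zero_mem _

theorem minDist_le_of_mem_code {I : Finset (Fin (2 ^ n))} {f : Fin (2 ^ n) → ZMod 2}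
    (hf : f ∈ code I) (h0 : f ≠ 0) : minDist I ≤ hammingNorm f :=
  Nat.sInf_le ⟨f, hf, 0, Submodule.zero_mem _, h0, hammingDist_zero_right f⟩

theorem row_ne_zero (x : Fin (2 ^ n)) : row x ≠ 0 := by
  rw [← hammingNorm_ne_zero_iff, hammingNorm_row]
  positivity

theorem row_mem_code {I : Finset (Fin (2 ^ n))} {x : Fin (2 ^ n)} (hx : x ∈ I) :
    row x ∈ code I :=
  Submodule.subset_span ⟨x, hx, rfl⟩

theorem minDist_le {I : Finset (Fin (2 ^ n))} {x : Fin (2 ^ n)} (hx : x ∈ I) :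
    minDist I ≤ 2 ^ (binSupp x).card :=
  (minDist_le_of_mem_code (row_mem_code hx) (row_ne_zero x)).trans_eq (hammingNorm_row x)

/-- No order property is required, so this also applies to the exchanged set, which need not have
one. -/
theorem minDist_eq {I : Finset (Fin (2 ^ n))} {r : ℕ} (hI : ∀ h ∈ I, r ≤ (binSupp h).card)
    {x : Fin (2 ^ n)} (hx : x ∈ I) (hxr : (binSupp x).card = r) : minDist I = 2 ^ r := by
  refine le_antisymm (hxr ▸ minDist_le hx) (le_csInf
    ⟨_, row x, row_mem_code hx, 0, Submodule.zero_mem _, row_ne_zero x, rfl⟩ ?_)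
  rintro d ⟨f, hf, g, hg, hfg, rfl⟩
  obtain ⟨c, hc, hcf⟩ := mem_code.1 (Submodule.add_mem _ (Submodule.neg_mem _ hf) hg)
  rw [hammingDist_eq_hammingNorm, ← hcf]
  refine two_pow_le_hammingNorm_ev ?_ fun h hh => hI h (by_contra fun h' => hh (hc h h'))
  rintro rfl
  rw [ev_zero] at hcf
  exact hfg (neg_add_eq_zero.1 hcf.symm)

/-- The coefficient vectors of the words of weight `2 ^ r` of `C(I)`. -/
def minWords (I : Finset (Fin (2 ^ n))) (r : ℕ) : Set (Fin (2 ^ n) → ZMod 2) :=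
  {c | (∀ h ∉ I, c h = 0) ∧ hammingNorm (ev c) = 2 ^ r}

theorem errorCoeff_eq {I : Finset (Fin (2 ^ n))} {r : ℕ} (h : minDist I = 2 ^ r) :
    errorCoeff I = (minWords I r).ncard := by
  rw [errorCoeff, ← Set.ncard_image_of_injective (minWords I r) ev_injective]
  congr 1
  ext f
  simp only [Set.mem_ofPred_eq, Set.mem_image, mem_code, h, minWords]
  constructor
  · rintro ⟨⟨c, hc, rfl⟩, hw⟩
    exact ⟨c, ⟨hc, hw⟩, rfl⟩
  · rintro ⟨c, ⟨hc, hw⟩, rfl⟩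
    exact ⟨⟨c, hc, rfl⟩, hw⟩

theorem exists_isMin_of_mem_minWords {I : Finset (Fin (2 ^ n))} {r : ℕ}
    (hI : ∀ h ∈ I, r ≤ (binSupp h).card) {c : Fin (2 ^ n) → ZMod 2} (hc : c ∈ minWords I r) :
    ∃ x ∈ I, (binSupp x).card = r ∧ IsMin x c := by
  have h0 : c ≠ 0 := by
    rintro rfl
    have := hc.2
    rw [ev_zero, hammingNorm_zero] at this
    exact (pow_pos two_pos r).ne this
  have hsupp : ∀ h, c h ≠ 0 → h ∈ I := fun h hh => by_contra fun h' => hh (hc.1 h h')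
  obtain ⟨x, hx⟩ := exists_leads h0
  exact ⟨x, hsupp x (by rw [hx.1]; exact one_ne_zero),
    isMin_of_leads hx (fun h hh => hI h (hsupp h hh)) hc.2⟩

theorem IsMin.mem_minWords {I : Finset (Fin (2 ^ n))} (hI : PartialOrderProperty I)
    {x : Fin (2 ^ n)} (hx : x ∈ I) {c : Fin (2 ^ n) → ZMod 2} (hc : IsMin x c) :
    c ∈ minWords I (binSupp x).card :=
  ⟨fun h hh => by_contra fun h0 => hI x hx h hh (hc.PO h0), hc.2.2⟩

/-- Removing `j` from `I` destroys at least `∑ 2 ^ (|K_x| - 1) + 2 ^ |K_j|` minimum weight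
words. -/
theorem sum_add_le_ncard {I : Finset (Fin (2 ^ n))} (hI : PartialOrderProperty I) {r : ℕ}
    {j : Fin (2 ^ n)} (hj : j ∈ I) (hjr : (binSupp j).card = r) {D : Finset (Fin (2 ^ n))}
    (hD : ∀ x ∈ D, x ∈ I ∧ (binSupp x).card = r ∧ j ∈ setK x) :
    ∑ x ∈ D, 2 ^ ((setK x).card - 1) + 2 ^ (setK j).card ≤
      {c ∈ minWords I r | c j ≠ 0}.ncard := by
  have hcount : (⋃ x ∈ D, {c | IsMin x c ∧ c j = 1}).ncard =
      ∑ x ∈ D, 2 ^ ((setK x).card - 1) := by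
    rw [Finset.sum_congr rfl fun x hx => (ncard_isMin_coeff (hD x hx).2.2 1).symm]
    clear hD
    induction D using Finset.induction_on with
    | empty => simp
    | insert y D hy ih =>
      rw [Finset.set_biUnion_insert, Finset.sum_insert hy, Set.ncard_union_eq, ih]
      -- Words counted for different elements of `D` differ in their leading term.
      refine Set.disjoint_left.2 fun c hc hc' => ?_
      simp only [Set.mem_iUnion] at hc'
      obtain ⟨x, hx, hc', _⟩ := hc'
      exact hy (hc.1.1.unique hc'.1 ▸ hx)
  rw [← hcount, ← ncard_isMin j, ← Set.ncard_union_eq]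
  · refine Set.ncard_le_ncard ?_ (Set.toFinite _)
    rintro c (hc | hc)
    · simp only [Set.mem_iUnion] at hc
      obtain ⟨x, hx, hc, hcj⟩ := hc
      exact ⟨(hD x hx).2.1 ▸ hc.mem_minWords hI (hD x hx).1, by rw [hcj]; exact one_ne_zero⟩
    · exact ⟨hjr ▸ IsMin.mem_minWords hI hj hc, by rw [hc.1.1]; exact one_ne_zero⟩
  · refine Set.disjoint_left.2 fun c hc hc' => ?_
    simp only [Set.mem_iUnion] at hc
    obtain ⟨x, hx, hc, _⟩ := hc
    exact (mem_setK.1 (hD x hx).2.2).1.ne (hc.1.unique hc'.1)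

/-- The minimum weight words gained by exchanging `j` for `i` have leading term `i`. -/
theorem minWords_exchange_subset {I : Finset (Fin (2 ^ n))} (hI : PartialOrderProperty I) {r : ℕ}
    (hr : ∀ h ∈ I, r ≤ (binSupp h).card) {i j : Fin (2 ^ n)} (hij : i ≠ j)
    (hir : (binSupp i).card = r) :
    minWords (insert i (I \ {j})) r ⊆
      {c ∈ minWords I r | c j = 0} ∪ {c | IsMin i c ∧ c j = 0} := by
  intro c hc
  have hcj : c j = 0 := hc.1 j (by simp [hij.symm])
  obtain ⟨x, hx, hxr, hmin⟩ := exists_isMin_of_mem_minWords (by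
    intro h hh
    rcases Finset.mem_insert.1 hh with rfl | hh
    · exact hir.ge
    · exact hr h (Finset.mem_sdiff.1 hh).1) hc
  rcases Finset.mem_insert.1 hx with rfl | hx
  · exact Or.inr ⟨hmin, hcj⟩
  -- The leading term lies in `I`, so the order property keeps every term in `I`, even though `i`
  -- was allowed.
  · exact Or.inl ⟨hxr ▸ hmin.mem_minWords hI (Finset.mem_sdiff.1 hx).1, hcj⟩

end PolarCode

/-! ### The exchange inequality. -/

open PolarCode in
theorem proposition2 (n : ℕ) (I : Finset (Fin (2 ^ n))) (hI : PartialOrderProperty I)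
    (j : Fin (2 ^ n)) (hj : j ∈ setB I)
    (i : Fin (2 ^ n)) (hi : i ∈ setE I j ∩ setBc I)
    (hij : (∑ x ∈ setD I j, (2 : ℚ) ^ (((setK x).card : ℤ) - 1)) + (2 : ℚ) ^ (setK j).card
      > (2 : ℚ) ^ (((setK i).card : ℤ) - 1)) :
    errorCoeff (insert i (I \ {j})) < errorCoeff I := by
  obtain ⟨hjI, hjw⟩ := Finset.mem_filter.1 hj
  rw [hammingNorm_row] at hjw
  obtain ⟨r, hjr⟩ : ∃ r, (binSupp j).card = r := ⟨_, rfl⟩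
  rw [hjr] at hjw
  have hr : ∀ h ∈ I, r ≤ (binSupp h).card := fun h hh =>
    (Nat.pow_le_pow_iff_right (by norm_num : 1 < 2)).1 (hjw ▸ minDist_le hh)
  have hE : ∀ x ∈ setE I j, x < j ∧ (binSupp x).card = r ∧ j ∈ setK x := by
    intro x hx
    obtain ⟨hxj, hxw, hxc⟩ := (Finset.mem_filter.1 hx).2
    have hxr : (binSupp x).card = r := Nat.pow_right_injective le_rfl (hxw.trans hjw.symm)
    exact ⟨hxj, hxr, mem_setK.2 ⟨hxj, by rw [hxr, hjr], by rwa [Finset.inter_comm]⟩⟩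
  obtain ⟨hlt, hir, hK⟩ := hE i (Finset.mem_inter.1 hi).1
  have hD : ∀ x ∈ setD I j, x ∈ I ∧ (binSupp x).card = r ∧ j ∈ setK x := fun x hx =>
    ⟨(Finset.mem_filter.1 (Finset.mem_inter.1 hx).2).1, (hE x (Finset.mem_inter.1 hx).1).2⟩
  -- The exponent `|K_x| - 1` is an integer and could be `-1`; since `j ∈ K_x` here, it agrees with
  -- the truncated one.
  have hcast : ∀ x, j ∈ setK x →
      (2 : ℚ) ^ (((setK x).card : ℤ) - 1) = ((2 ^ ((setK x).card - 1) : ℕ) : ℚ) := by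
    intro x hx
    have : 1 ≤ (setK x).card := Finset.card_pos.2 ⟨j, hx⟩
    rw [← Nat.cast_one, ← Nat.cast_sub this, zpow_natCast]
    push_cast
    rfl
  rw [hcast i hK, Finset.sum_congr rfl fun x hx => hcast x (hD x hx).2.2] at hij
  have hineq : 2 ^ ((setK i).card - 1) <
      ∑ x ∈ setD I j, 2 ^ ((setK x).card - 1) + 2 ^ (setK j).card := by
    exact_mod_cast hij
  have hdist' : minDist (insert i (I \ {j})) = 2 ^ r := by
    refine minDist_eq (fun h hh => ?_) (Finset.mem_insert_self _ _) hir
    rcases Finset.mem_insert.1 hh with rfl | hh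
    · exact hir.ge
    · exact hr h (Finset.mem_sdiff.1 hh).1
  rw [errorCoeff_eq hdist', errorCoeff_eq hjw.symm]
  have hlost := sum_add_le_ncard hI hjI hjr hD
  have hgain := (Set.ncard_le_ncard (minWords_exchange_subset hI hr hlt.ne hir)
    (Set.toFinite _)).trans (Set.ncard_union_le _ _)
  rw [ncard_isMin_coeff hK] at hgain
  -- The words with coefficient `0` at `j` appear in both counts, so only the lost and the gained
  -- words are compared.
  have hsplit : {c ∈ minWords I r | c j = 0}.ncard + {c ∈ minWords I r | c j ≠ 0}.ncard =
      (minWords I r).ncard := by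
    rw [← Set.ncard_union_eq (Set.disjoint_left.2 fun c h h' => h'.2 h.2)]
    congr 1
    ext c
    simp only [Set.mem_union, Set.mem_ofPred_eq]
    tauto
  omega
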